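/- Fix an integer $t\geq 1$. Consider $t$ stacks in series: the entries of a permutation $\pi=\pi_1\cdots\pi_n$ of $\{1,\ldots,n\}$ are read from left to right, every entry passes from the input to the first stack, from the first stack to the second, and so on, and finally from the $t$-th stack to the output. Moving the first remaining input entry to the first stack, or the top entry of a stack to the next stack, is legal if the receiving stack is empty or the moved entry is smaller than its top entry (so every stack stays increasing from top to bottom); moving the top entry of the $t$-th stack to the output is legal if that entry is the smallest one that has not yet been output. The left-greedy algorithm repeatedly performs, among all legal moves, the one closest to the output, and halts when no move is legal. Let $\widehat{\mathcal W}_t(n)$ be the set of permutations of $\{1,\ldots,n\}$ that are sorted by this algorithm, i.e., for which the output becomes $1,2,\ldots,n$. Then the limit $\lim_{n\to\infty}|\widehat{\mathcal W}_t(n)|^{1/n}$ exists (as a real number), and \[\lim_{n\to\infty}|\widehat{\mathcal W}_t(n)|^{1/n}\geq(\sqrt t+1)^2.\] -/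

import Mathlib

/-- A configuration of a system of stacks in series, recorded as a sequence of containers through
which the entries travel one step at a time: container `0` is the remaining input (head = next
entry to be read), containers `1, …, t` are the stacks in the order in which entries pass through
them (head = top), and container `t + 1` is the output (head = most recently output entry). -/
abbrev StackConfig := ℕ → List ℕ

/-- Move the head entry of container `k` to the head of container `k + 1`. -/
def StackConfig.move (S : StackConfig) (k : ℕ) : StackConfig := fun j =>
  if j = k then (S k).tail
  else if j = k + 1 then (S k).head?.toList ++ S (k + 1)
  else S j

/-- Legality of the move from container `k` to container `k + 1` (`k ≤ t`). There must be an entry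
`x` to move. A stack is never allowed to carry an entry on top of a smaller one (so stacks increase
from top to bottom), and an entry may be output only when it is the next one needed in order for
the output to be `1, 2, 3, …`. -/
def StackConfig.Legal (t : ℕ) (S : StackConfig) (k : ℕ) : Prop :=
  ∃ x ∈ (S k).head?,
    (k < t ∧ ∀ y ∈ (S (k + 1)).head?, x < y) ∨ (k = t ∧ x = (S (t + 1)).length + 1)

/-- One step of the left-greedy algorithm with `t` stacks in series: among all the legal moves,
perform the one closest to the output. (The output is drawn on the left and the input on the right,
so this is the leftmost legal move.) If there is no legal move, the algorithm halts. -/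
def LeftGreedyStep (t : ℕ) (S S' : StackConfig) : Prop :=
  ∃ k ≤ t, S.Legal t k ∧ (∀ j, k < j → j ≤ t → ¬ S.Legal t j) ∧ S' = S.move k

/-- The one-line notation `π₁ π₂ ⋯ πₙ`, with entries `1, …, n`. -/
def oneLine {n : ℕ} (π : Equiv.Perm (Fin n)) : List ℕ :=
  List.ofFn fun i => (π i : ℕ) + 1

/-- The starting configuration: the permutation is the input; stacks and output are empty. -/
def initialConfig {n : ℕ} (π : Equiv.Perm (Fin n)) : StackConfig := fun j =>
  if j = 0 then oneLine π else []

/-- `π` is sorted by `t` stacks in series via the left-greedy algorithm: the run of the (deterministic)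
algorithm on input `π` arrives at a configuration in which the output is `1, 2, …, n`. -/
def LeftGreedySortable (t : ℕ) {n : ℕ} (π : Equiv.Perm (Fin n)) : Prop :=
  ∃ S : StackConfig, Relation.ReflTransGen (LeftGreedyStep t) (initialConfig π) S ∧
    (S (t + 1)).reverse = List.range' 1 n

/-- The set of permutations in `Sₙ` that can be sorted by `t` stacks in series using the
left-greedy algorithm. -/
def leftGreedySortableSet (t n : ℕ) : Set (Equiv.Perm (Fin n)) :=
  {π | LeftGreedySortable t π}

/-! Existence of the limit. Direct sums of sortable permutations are sortable
(`SortsList.directSum`): the second summand waits in the input until the first has been output. So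
the counts are supermultiplicative. They grow at most exponentially, because every successful run
consists of (t+1)n reversible moves ending in the same configuration. Fekete's lemma then gives a
limit L, and also that the n-th count is at most L^n for every n.

Lower bound. A permutation avoiding every pattern X (t+2) 1, with X an arrangement of 2, …, t+1, is
sorted (`RunInvariant.sorted_of_stuck`): if the algorithm is stuck too early, the next input entry,
the tops of the t stacks and the next entry to be output form such a pattern. Avoiders are built by
appending last entries, which leads to the generating tree with root 1 and rule k ↦ e + 1 + min(t, k
- e), 0 ≤ e < k.

If L < (√t+1)², then the generating functions of the subtrees with root label t + k converge at some
x > 0 for which they satisfy, in k, a linear recurrence of order two with negative discriminant.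
Their values are positive, which is impossible (`false_of_positive_solution`). -/

/-! ### Permutations as lists -/

/-- The configuration in which the input is `l` and all other containers are empty. -/
def inputConfig (l : List ℕ) : StackConfig := fun j => if j = 0 then l else []

/-- The left-greedy algorithm with `t` stacks outputs `1, …, l.length` on input `l`. -/
def SortsList (t : ℕ) (l : List ℕ) : Prop :=
  ∃ S : StackConfig, Relation.ReflTransGen (LeftGreedyStep t) (inputConfig l) S ∧
    (S (t + 1)).reverse = List.range' 1 l.length

theorem length_oneLine {n : ℕ} (π : Equiv.Perm (Fin n)) : (oneLine π).length = n := by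
  simp [oneLine]

theorem leftGreedySortable_iff (t : ℕ) {n : ℕ} (π : Equiv.Perm (Fin n)) :
    LeftGreedySortable t π ↔ SortsList t (oneLine π) := by
  unfold LeftGreedySortable SortsList
  rw [length_oneLine]
  rfl

theorem oneLine_injective (n : ℕ) : Function.Injective (@oneLine n) := by
  intro π σ h
  unfold oneLine at h
  have h' := List.ofFn_injective h
  ext i
  have := congrFun h' i
  simpa using this

theorem oneLine_perm {n : ℕ} (π : Equiv.Perm (Fin n)) : (oneLine π).Perm (List.range' 1 n) := by
  rw [List.perm_ext_iff_of_nodup]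
  · intro a
    simp only [oneLine, List.mem_ofFn, List.mem_range'_1]
    constructor
    · rintro ⟨i, rfl⟩
      have := (π i).isLt
      omega
    · rintro ⟨h1, h2⟩
      refine ⟨π.symm ⟨a - 1, by omega⟩, ?_⟩
      simp
      omega
  · unfold oneLine
    rw [List.nodup_ofFn]
    intro i j h
    apply π.injective
    ext
    simpa using h
  · exact List.nodup_range'

theorem exists_oneLine_eq {n : ℕ} {l : List ℕ} (h : l.Perm (List.range' 1 n)) :
    ∃ π : Equiv.Perm (Fin n), oneLine π = l := by
  have hlen : l.length = n := by simpa using h.length_eq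
  have hnd : l.Nodup := h.nodup_iff.2 List.nodup_range'
  have hmem : ∀ i (hi : i < l.length), 1 ≤ l[i] ∧ l[i] < 1 + n := by
    intro i hi
    have := h.mem_iff.1 (List.getElem_mem hi)
    simpa [List.mem_range'_1] using this
  let f : Fin n → Fin n := fun i =>
    ⟨l[(i : ℕ)]'(by omega) - 1, by have := hmem i (by omega); omega⟩
  have hf : Function.Injective f := by
    intro i j hij
    have hi := hmem i (by omega)
    have hj := hmem j (by omega)
    have h1 : l[(i : ℕ)]'(by omega) = l[(j : ℕ)]'(by omega) := by
      have := congrArg Fin.val hij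
      simp only [f] at this
      omega
    ext
    exact (hnd.getElem_inj_iff).1 h1
  refine ⟨Equiv.ofBijective f (Finite.injective_iff_bijective.1 hf), ?_⟩
  apply List.ext_getElem
  · simp [oneLine, hlen]
  · intro i h1 h2
    have := hmem i h2
    simp [oneLine, f]
    omega

/-- The lists that are one-line notations of sortable permutations of `{1, …, n}`. -/
def sortableLists (t n : ℕ) : Set (List ℕ) :=
  {l | l.Perm (List.range' 1 n) ∧ SortsList t l}

theorem image_oneLine (t n : ℕ) :
    oneLine '' leftGreedySortableSet t n = sortableLists t n := by
  ext l
  constructor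
  · rintro ⟨π, hπ, rfl⟩
    exact ⟨oneLine_perm π, (leftGreedySortable_iff t π).1 hπ⟩
  · rintro ⟨h1, h2⟩
    obtain ⟨π, rfl⟩ := exists_oneLine_eq h1
    exact ⟨π, (leftGreedySortable_iff t π).2 h2, rfl⟩

theorem ncard_sortableLists (t n : ℕ) :
    (sortableLists t n).ncard = (leftGreedySortableSet t n).ncard := by
  rw [← image_oneLine, Set.ncard_image_of_injective _ (oneLine_injective n)]

theorem finite_sortableLists (t n : ℕ) : (sortableLists t n).Finite := by
  rw [← image_oneLine]
  exact (Set.toFinite _).image _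

/-! ### Quantities preserved by moves -/

/-- Only two containers change, so all other terms form a common remainder `R`. Taking `F` to be the
multiset of entries or the weighted length yields the behaviour of `entries` and `progress`. -/
theorem sum_move {M : Type*} [AddCommMonoid M] (F : ℕ → List ℕ → M) (S : StackConfig) {k N : ℕ}
    (hk : k + 1 < N) :
    ∃ R, ∑ j ∈ Finset.range N, F j (S j) = F k (S k) + (F (k + 1) (S (k + 1)) + R) ∧
      ∑ j ∈ Finset.range N, F j (S.move k j) =
        F k (S k).tail + (F (k + 1) ((S k).head?.toList ++ S (k + 1)) + R) := by
  have h1 : k ∈ Finset.range N := by simp; omega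
  have h2 : k + 1 ∈ (Finset.range N).erase k := by simp; omega
  refine ⟨∑ j ∈ ((Finset.range N).erase k).erase (k + 1), F j (S j), ?_, ?_⟩
  · rw [Finset.add_sum_erase _ (fun j => F j (S j)) h2,
      Finset.add_sum_erase _ (fun j => F j (S j)) h1]
  · rw [← Finset.add_sum_erase _ _ h1, ← Finset.add_sum_erase _ _ h2]
    congr 1
    · simp [StackConfig.move]
    · congr 1
      · simp [StackConfig.move]
      · apply Finset.sum_congr rfl
        intro j hj
        simp only [Finset.mem_erase] at hj
        simp [StackConfig.move, hj.1, hj.2.1]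

/-- The multiset of all entries in the containers `0, …, t + 1`. -/
def entries (t : ℕ) (S : StackConfig) : Multiset ℕ :=
  ∑ j ∈ Finset.range (t + 2), (S j : Multiset ℕ)

/-- The total number of moves made so far by all entries. -/
def progress (t : ℕ) (S : StackConfig) : ℕ :=
  ∑ j ∈ Finset.range (t + 2), j * (S j).length

theorem entries_step {t : ℕ} {S S' : StackConfig} (h : LeftGreedyStep t S S') :
    entries t S' = entries t S := by
  obtain ⟨k, hk, ⟨x, hx, -⟩, -, rfl⟩ := h
  obtain ⟨R, h1, h2⟩ := sum_move (fun _ l => (l : Multiset ℕ)) S (k := k) (N := t + 2) (by omega)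
  unfold entries
  rw [h1, h2]
  obtain ⟨tl, htl⟩ : ∃ tl, S k = x :: tl := by
    cases hS : S k <;> simp_all
  rw [htl]
  simp only [List.tail_cons, List.head?_cons, Option.toList_some, List.cons_append,
    List.nil_append, ← Multiset.cons_coe, ← Multiset.singleton_add]
  abel

theorem progress_step {t : ℕ} {S S' : StackConfig} (h : LeftGreedyStep t S S') :
    progress t S' = progress t S + 1 := by
  obtain ⟨k, hk, ⟨x, hx, -⟩, -, rfl⟩ := h
  obtain ⟨R, h1, h2⟩ := sum_move (fun j l => j * l.length) S (k := k) (N := t + 2) (by omega)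
  unfold progress
  rw [h1, h2]
  obtain ⟨tl, htl⟩ : ∃ tl, S k = x :: tl := by
    cases hS : S k <;> simp_all
  rw [htl]
  simp
  ring

theorem entries_inputConfig (t : ℕ) (l : List ℕ) : entries t (inputConfig l) = l := by
  unfold entries inputConfig
  rw [Finset.sum_eq_single 0] <;> simp +contextual

theorem progress_inputConfig (t : ℕ) (l : List ℕ) : progress t (inputConfig l) = 0 := by
  unfold progress inputConfig
  apply Finset.sum_eq_zero
  intro j _
  by_cases h : j = 0 <;> simp [h]

theorem entries_run {t : ℕ} {S S' : StackConfig}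
    (h : Relation.ReflTransGen (LeftGreedyStep t) S S') : entries t S' = entries t S := by
  induction h with
  | refl => rfl
  | tail _ h ih => rw [entries_step h, ih]

theorem beyond_output_run {t : ℕ} {S S' : StackConfig}
    (h : Relation.ReflTransGen (LeftGreedyStep t) S S') {j : ℕ} (hj : t + 1 < j) :
    S' j = S j := by
  induction h with
  | refl => rfl
  | tail _ h ih =>
    obtain ⟨k, hk, -, -, rfl⟩ := h
    rw [← ih, StackConfig.move, if_neg (by omega), if_neg (by omega)]

/-- The configuration in which `1, …, n` have been output and all other containers are empty. -/
def sortedConfig (t n : ℕ) : StackConfig := fun j =>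
  if j = t + 1 then (List.range' 1 n).reverse else []

/-- Entries are conserved, so a full output leaves nothing for the containers before it; those
beyond it are never touched. -/
theorem eq_sortedConfig {t : ℕ} {l : List ℕ} {S : StackConfig}
    (h : Relation.ReflTransGen (LeftGreedyStep t) (inputConfig l) S)
    (hS : (S (t + 1)).reverse = List.range' 1 l.length) : S = sortedConfig t l.length := by
  have hout : S (t + 1) = (List.range' 1 l.length).reverse := by rw [← hS, List.reverse_reverse]
  funext j
  unfold sortedConfig
  split_ifs with hj
  · rw [hj, hout]
  · rcases lt_or_gt_of_ne hj with hj | hj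
    · have h1 := congrArg Multiset.card (entries_run h)
      rw [entries_inputConfig, entries, Finset.sum_range_succ, Multiset.card_add, hout] at h1
      simp only [Multiset.coe_card, List.length_reverse, List.length_range', Multiset.card_sum,
        Nat.add_eq_right] at h1
      rw [Finset.sum_eq_zero_iff] at h1
      exact List.eq_nil_of_length_eq_zero (h1 j (by simpa using hj))
    · rw [beyond_output_run h hj]
      exact if_neg (by omega)

theorem sortsList_iff {t : ℕ} {l : List ℕ} :
    SortsList t l ↔
      Relation.ReflTransGen (LeftGreedyStep t) (inputConfig l) (sortedConfig t l.length) := by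
  constructor
  · rintro ⟨S, h, hS⟩
    rwa [← eq_sortedConfig h hS]
  · intro h
    exact ⟨_, h, by simp [sortedConfig]⟩

/-! ### Direct sums -/

theorem legal_congr {t k : ℕ} {S T : StackConfig} (h0 : T k = S k) (h1 : T (k + 1) = S (k + 1))
    (h2 : T (t + 1) = S (t + 1)) : T.Legal t k ↔ S.Legal t k := by
  unfold StackConfig.Legal
  rw [h0, h1, h2]

/-- Extend the remaining input by `r`. -/
def extendInput (r : List ℕ) (S : StackConfig) : StackConfig := fun j =>
  if j = 0 then S 0 ++ r else S j

/-- A longer input can only make the move from container 0 newly legal. That move has the lowest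
priority, so it never overrides the step chosen before. -/
theorem step_extendInput {t : ℕ} (r : List ℕ) {S S' : StackConfig} (h : LeftGreedyStep t S S') :
    LeftGreedyStep t (extendInput r S) (extendInput r S') := by
  obtain ⟨k, hk, hl, hn, rfl⟩ := h
  have hpos : ∀ j, 0 < j → ((extendInput r S).Legal t j ↔ S.Legal t j) := fun j hj =>
    legal_congr (if_neg (by omega)) (if_neg (by omega)) (if_neg (by omega))
  refine ⟨k, hk, ?_, fun j hj hjt => by rw [hpos j (by omega)]; exact hn j hj hjt, ?_⟩
  · rcases Nat.eq_zero_or_pos k with rfl | hk0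
    · obtain ⟨x, hx, hx'⟩ := hl
      refine ⟨x, ?_, ?_⟩
      · cases hS : S 0 <;> simp_all [extendInput]
      · simpa [extendInput] using hx'
    · exact (hpos k hk0).2 hl
  · obtain ⟨x, hx, -⟩ := hl
    funext j
    cases hS : S k with
    | nil => simp [hS] at hx
    | cons y tl =>
      rcases Nat.eq_zero_or_pos k with rfl | hk0
      · by_cases h0 : j = 0
        · simp [extendInput, StackConfig.move, h0, hS]
        · by_cases h1 : j = 1 <;> simp [extendInput, StackConfig.move, h0, h1, hS]
      · by_cases h0 : j = 0
        · subst h0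
          simp [extendInput, StackConfig.move, hk0.ne]
        · simp [extendInput, StackConfig.move, h0, hk0.ne']

/-- Raise all entries by `m`, and put the entries `1, …, m` before the output. -/
def shiftConfig (t m : ℕ) (S : StackConfig) : StackConfig := fun j =>
  (S j).map (· + m) ++ if j = t + 1 then (List.range' 1 m).reverse else []

/-- Comparisons are invariant under the shift, and the m extra output entries raise the next
required value by m as well. -/
theorem legal_shiftConfig {t m k : ℕ} (hk : k ≤ t) (S : StackConfig) :
    (shiftConfig t m S).Legal t k ↔ S.Legal t k := by
  have h0 : shiftConfig t m S k = (S k).map (· + m) := by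
    simp only [shiftConfig, if_neg (show k ≠ t + 1 by omega), List.append_nil]
  have h1 : k < t → shiftConfig t m S (k + 1) = (S (k + 1)).map (· + m) := by
    intro hk
    simp only [shiftConfig, if_neg (show k + 1 ≠ t + 1 by omega), List.append_nil]
  have h2 : (shiftConfig t m S (t + 1)).length = (S (t + 1)).length + m := by
    simp [shiftConfig]
  unfold StackConfig.Legal
  rw [h0, h2]
  constructor
  · rintro ⟨x, hx, h⟩
    simp only [List.head?_map, Option.mem_def, Option.map_eq_some_iff] at hx
    obtain ⟨y, hy, rfl⟩ := hx
    refine ⟨y, hy, ?_⟩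
    rcases h with ⟨hkt, h⟩ | ⟨hkt, h⟩
    · left
      refine ⟨hkt, fun z hz => ?_⟩
      rw [h1 hkt] at h
      have := h (z + m) (by simp at hz; simp [hz])
      omega
    · right
      exact ⟨hkt, by omega⟩
  · rintro ⟨y, hy, h⟩
    refine ⟨y + m, by simp at hy; simp [hy], ?_⟩
    rcases h with ⟨hkt, h⟩ | ⟨hkt, h⟩
    · left
      refine ⟨hkt, ?_⟩
      rw [h1 hkt]
      intro z hz
      simp only [List.head?_map, Option.mem_def, Option.map_eq_some_iff] at hz
      obtain ⟨w, hw, rfl⟩ := hz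
      have := h w hw
      omega
    · right
      exact ⟨hkt, by omega⟩

theorem step_shiftConfig {t : ℕ} (m : ℕ) {S S' : StackConfig} (h : LeftGreedyStep t S S') :
    LeftGreedyStep t (shiftConfig t m S) (shiftConfig t m S') := by
  obtain ⟨k, hk, hl, hn, rfl⟩ := h
  refine ⟨k, hk, (legal_shiftConfig hk S).2 hl,
    fun j hj hjt => by rw [legal_shiftConfig hjt]; exact hn j hj hjt, ?_⟩
  obtain ⟨x, hx, -⟩ := hl
  funext j
  have hkt : k ≠ t + 1 := by omega
  cases hS : S k with
  | nil => simp [hS] at hx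
  | cons y tl =>
    by_cases h0 : j = k
    · subst h0
      simp [shiftConfig, StackConfig.move, hS, hkt]
    · by_cases h1 : j = k + 1
      · subst h1
        simp [shiftConfig, StackConfig.move, hS, hkt]
      · simp [shiftConfig, StackConfig.move, h0, h1]

theorem SortsList.directSum {t : ℕ} {l r : List ℕ} (hl : SortsList t l) (hr : SortsList t r) :
    SortsList t (l ++ r.map (· + l.length)) := by
  rw [sortsList_iff] at *
  have h1 := hl.lift (extendInput (r.map (· + l.length))) fun _ _ h => step_extendInput _ h
  have h2 := hr.lift (shiftConfig t l.length) fun _ _ h => step_shiftConfig _ h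
  simp only [Function.onFun] at h1 h2
  have e1 : extendInput (r.map (· + l.length)) (inputConfig l) =
      inputConfig (l ++ r.map (· + l.length)) := by
    funext j
    by_cases h : j = 0 <;> simp [extendInput, inputConfig, h]
  -- The end of the run on `l` is the start of the shifted run on `r`, so the two runs can be
  -- concatenated.
  have e2 : extendInput (r.map (· + l.length)) (sortedConfig t l.length) =
      shiftConfig t l.length (inputConfig r) := by
    funext j
    by_cases h : j = 0
    · simp [extendInput, inputConfig, shiftConfig, sortedConfig, h]
    · simp [extendInput, inputConfig, shiftConfig, sortedConfig, h]
  have e3 : shiftConfig t l.length (sortedConfig t r.length) =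
      sortedConfig t (l ++ r.map (· + l.length)).length := by
    funext j
    by_cases h : j = t + 1
    · simp only [shiftConfig, sortedConfig, h, if_true, List.length_append, List.length_map,
        List.map_reverse, ← List.reverse_append]
      congr 1
      rw [← List.range'_append_1]
      congr 1
      rw [show (fun x => x + l.length) = (l.length + ·) from funext fun x => Nat.add_comm _ _,
        List.map_add_range', Nat.add_comm]
    · simp [shiftConfig, sortedConfig, h]
  rw [e1, e2] at h1
  rw [e3] at h2
  exact h1.trans h2

theorem ncard_mul_le (t m n : ℕ) :
    (sortableLists t m).ncard * (sortableLists t n).ncard ≤ (sortableLists t (m + n)).ncard := by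
  rw [← Set.ncard_prod]
  refine Set.ncard_le_ncard_of_injOn (fun p : List ℕ × List ℕ => p.1 ++ p.2.map (· + m)) ?_ ?_
    (finite_sortableLists _ _)
  · rintro ⟨l, r⟩ ⟨⟨hl1, hl2⟩, hr1, hr2⟩
    have hlen : l.length = m := by simpa using hl1.length_eq
    refine ⟨?_, ?_⟩
    · simp only
      rw [← List.range'_append_1]
      refine hl1.append ?_
      have := hr1.map (m + ·)
      rw [List.map_add_range'] at this
      rw [show (fun x => x + m) = (m + ·) from funext fun x => Nat.add_comm _ _, Nat.add_comm 1 m]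
      exact this
    · have := hl2.directSum hr2
      rwa [hlen] at this
  · rintro ⟨l, r⟩ ⟨⟨hl1, -⟩, -⟩ ⟨l', r'⟩ ⟨⟨hl1', -⟩, -⟩ h
    have hlen : l.length = l'.length := by rw [hl1.length_eq, hl1'.length_eq]
    obtain ⟨h1, h2⟩ := List.append_inj h hlen
    simp only at h1 h2
    rw [h1, (List.map_injective_iff.2 (add_left_injective m)) h2]

/-! ### Exponential upper bound -/

/-- Undo a move from container `k` to container `k + 1`. -/
def StackConfig.unmove (S : StackConfig) (k : ℕ) : StackConfig := fun j =>
  if j = k then (S (k + 1)).head?.toList ++ S k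
  else if j = k + 1 then (S (k + 1)).tail
  else S j

theorem unmove_move {t k : ℕ} {S : StackConfig} (h : S.Legal t k) : (S.move k).unmove k = S := by
  obtain ⟨x, hx, -⟩ := h
  cases hS : S k with
  | nil => simp [hS] at hx
  | cons y tl =>
    funext j
    by_cases h0 : j = k
    · subst h0
      simp [StackConfig.unmove, StackConfig.move, hS]
    · by_cases h1 : j = k + 1
      · subst h1
        simp [StackConfig.unmove, StackConfig.move, hS]
      · simp [StackConfig.unmove, StackConfig.move, h0, h1]

open Classical in
/-- The configurations obtained from `S` by undoing `i` moves. -/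
noncomputable def ancestors (t : ℕ) (S : StackConfig) : ℕ → Finset StackConfig
  | 0 => {S}
  | i + 1 => (Finset.range (t + 1)).biUnion fun k => (ancestors t S i).image fun T => T.unmove k

theorem card_ancestors_le (t : ℕ) (S : StackConfig) (i : ℕ) :
    (ancestors t S i).card ≤ (t + 1) ^ i := by
  classical
  induction i with
  | zero => simp [ancestors]
  | succ i ih =>
    rw [ancestors]
    refine Finset.card_biUnion_le.trans ?_
    refine (Finset.sum_le_card_nsmul _ _ ((t + 1) ^ i) fun k _ =>
      Finset.card_image_le.trans ih).trans ?_
    simp [pow_succ, mul_comm]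

/-- Each step raises `progress` by exactly one, so the difference is the length of the run, and each
of its moves can be undone. -/
theorem mem_ancestors {t : ℕ} {S T : StackConfig}
    (h : Relation.ReflTransGen (LeftGreedyStep t) T S) :
    progress t T ≤ progress t S ∧ T ∈ ancestors t S (progress t S - progress t T) := by
  classical
  induction h using Relation.ReflTransGen.head_induction_on with
  | refl => simp [ancestors]
  | @head A B h _ ih =>
    obtain ⟨ih1, ih2⟩ := ih
    have hp := progress_step h
    refine ⟨by omega, ?_⟩
    obtain ⟨k, hk, hl, -, rfl⟩ := h
    rw [show progress t S - progress t A = progress t S - progress t (A.move k) + 1 by omega,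
      ancestors]
    simp only [Finset.mem_biUnion, Finset.mem_image, Finset.mem_range]
    exact ⟨k, by omega, _, ih2, unmove_move hl⟩

theorem progress_sortedConfig (t n : ℕ) : progress t (sortedConfig t n) = (t + 1) * n := by
  unfold progress sortedConfig
  rw [Finset.sum_eq_single (t + 1)] <;> simp +contextual

theorem ncard_sortableLists_le (t n : ℕ) :
    (sortableLists t n).ncard ≤ ((t + 1) ^ (t + 1)) ^ n := by
  have hle := card_ancestors_le t (sortedConfig t n) ((t + 1) * n)
  rw [← pow_mul]
  refine le_trans ?_ hle
  rw [← Set.ncard_coe_finset]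
  apply Set.ncard_le_ncard_of_injOn inputConfig
  · rintro l ⟨h1, h2⟩
    have hlen : l.length = n := by simpa using h1.length_eq
    rw [sortsList_iff, hlen] at h2
    have := (mem_ancestors h2).2
    rwa [progress_sortedConfig, progress_inputConfig] at this
  · intro l _ l' _ h
    simpa [inputConfig] using congrFun h 0

/-! ### Pattern avoidance -/

/-- With `r` a sequence of entries written from right to left, putting `a` at its right end creates
no pattern `X (t + 2) 1`, where `X` is an arrangement of `2, …, t + 1`, whose last entry is `a`
(entries of `r` that are at least `a` count as larger than `a`). -/
def Insertable (t a : ℕ) : List ℕ → Prop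
  | [] => True
  | c :: r => (a ≤ c → r.countP (fun b => a ≤ b ∧ b < c) < t) ∧ Insertable t a r

/-- The sequence with distinct entries whose reverse is the given list avoids all patterns
`X (t + 2) 1`, where `X` is an arrangement of `2, …, t + 1`. -/
def ReverseAvoids (t : ℕ) : List ℕ → Prop
  | [] => True
  | a :: r => Insertable t a r ∧ ReverseAvoids t r

theorem Insertable.countP_lt {t a c : ℕ} {v u : List ℕ} (h : Insertable t a (v ++ c :: u))
    (hac : a ≤ c) : u.countP (fun b => a ≤ b ∧ b < c) < t := by
  induction v with
  | nil => exact h.1 hac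
  | cons x v ih => exact ih h.2

theorem ReverseAvoids.insertable {t a : ℕ} {w r : List ℕ} (h : ReverseAvoids t (w ++ a :: r)) :
    Insertable t a r := by
  induction w with
  | nil => exact h.1
  | cons x w ih => exact ih h.2

/-- Avoidance for the word read forwards: t distinct entries before `c` with values strictly between
`a` and `c`, followed by `c` and later `a`, would be a forbidden pattern. -/
theorem ReverseAvoids.countP_lt {t a c : ℕ} {u v : List ℕ}
    (h : ReverseAvoids t (u ++ c :: v).reverse) (ha : a ∈ v) (hac : a ≤ c) :
    u.countP (fun b => a ≤ b ∧ b < c) < t := by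
  obtain ⟨v₁, v₂, rfl⟩ := List.append_of_mem ha
  rw [show (u ++ c :: (v₁ ++ a :: v₂)).reverse =
    v₂.reverse ++ a :: (v₁.reverse ++ c :: u.reverse) by simp] at h
  have := h.insertable.countP_lt hac
  rwa [List.countP_reverse] at this

/-! ### Sorting permutations that avoid the patterns -/

/-- Properties of the configurations that occur during the run on input `l`. -/
structure RunInvariant (t : ℕ) (l : List ℕ) (S : StackConfig) : Prop where
  entries_eq : entries t S = l
  consumed : ∃ u, l = u ++ S 0 ∧ ∀ j, 1 ≤ j → ∀ x ∈ S j, x ∈ u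
  stacks_sorted : ∀ j, 1 ≤ j → j ≤ t → (S j).Pairwise (· < ·)
  output_eq : S (t + 1) = (List.range' 1 (S (t + 1)).length).reverse

theorem runInvariant_inputConfig (t : ℕ) (l : List ℕ) : RunInvariant t l (inputConfig l) where
  entries_eq := entries_inputConfig t l
  consumed := ⟨[], by simp [inputConfig], fun j hj x hx => by
    simp [inputConfig, show j ≠ 0 by omega] at hx⟩
  stacks_sorted j hj _ := by simp [inputConfig, show j ≠ 0 by omega]
  output_eq := by simp [inputConfig]

theorem RunInvariant.step {t : ℕ} {l : List ℕ} {S S' : StackConfig} (hS : RunInvariant t l S)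
    (h : LeftGreedyStep t S S') : RunInvariant t l S' := by
  have hent := (entries_step h).trans hS.entries_eq
  obtain ⟨k, hk, ⟨x, hx, hleg⟩, -, rfl⟩ := h
  obtain ⟨tl, htl⟩ : ∃ tl, S k = x :: tl := by
    cases hS : S k <;> simp_all
  have hk0 : S.move k k = tl := by simp [StackConfig.move, htl]
  have hk1 : S.move k (k + 1) = x :: S (k + 1) := by simp [StackConfig.move, htl]
  have hkj : ∀ j, j ≠ k → j ≠ k + 1 → S.move k j = S j := fun j h1 h2 => by
    simp [StackConfig.move, h1, h2]
  refine ⟨hent, ?_, ?_, ?_⟩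
  · obtain ⟨u, hu, hmem⟩ := hS.consumed
    rcases Nat.eq_zero_or_pos k with rfl | hpos
    · refine ⟨u ++ [x], by rw [hk0, hu, htl]; simp, fun j hj y hy => ?_⟩
      rcases eq_or_ne j 1 with rfl | hj1
      · rw [show (1 : ℕ) = 0 + 1 from rfl, hk1] at hy
        rcases List.mem_cons.1 hy with rfl | hy
        · simp
        · exact List.mem_append_left _ (hmem 1 le_rfl y hy)
      · rw [hkj j (by omega) (by omega)] at hy
        exact List.mem_append_left _ (hmem j hj y hy)
    · refine ⟨u, by rw [hkj 0 (by omega) (by omega)]; exact hu, fun j hj y hy => ?_⟩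
      rcases eq_or_ne j k with rfl | hjk
      · rw [hk0] at hy
        exact hmem j hj y (by rw [htl]; exact List.mem_cons_of_mem _ hy)
      · rcases eq_or_ne j (k + 1) with rfl | hjk1
        · rw [hk1] at hy
          rcases List.mem_cons.1 hy with rfl | hy
          · exact hmem k hpos y (by rw [htl]; exact List.mem_cons_self)
          · exact hmem _ hj y hy
        · rw [hkj j hjk hjk1] at hy
          exact hmem j hj y hy
  · intro j hj hjt
    rcases eq_or_ne j k with rfl | hjk
    · have := hS.stacks_sorted j hj hjt
      rw [htl] at this
      rw [hk0]
      exact this.of_cons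
    · rcases eq_or_ne j (k + 1) with rfl | hjk1
      · have hs := hS.stacks_sorted _ hj hjt
        rw [hk1]
        rcases hleg with ⟨-, hlt⟩ | ⟨h, -⟩
        · refine List.pairwise_cons.2 ⟨fun y hy => ?_, hs⟩
          cases hc : S (k + 1) with
          | nil => simp [hc] at hy
          | cons z zs =>
            have hxz : x < z := hlt z (by simp [hc])
            rw [hc] at hy hs
            rcases List.mem_cons.1 hy with rfl | hy
            · exact hxz
            · exact hxz.trans (List.rel_of_pairwise_cons hs hy)
        · omega
      · rw [hkj j hjk hjk1]
        exact hS.stacks_sorted j hj hjt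
  · rcases eq_or_ne k t with rfl | hkt
    · rcases hleg with ⟨h, -⟩ | ⟨-, hxl⟩
      · omega
      · rw [hk1, List.length_cons, List.range'_1_concat, List.reverse_append, hxl]
        conv_lhs => rw [hS.output_eq]
        simp [Nat.add_comm]
    · rw [hkj _ (by omega) (by omega)]
      exact hS.output_eq

theorem RunInvariant.disjoint {t : ℕ} {l : List ℕ} {S : StackConfig} (hS : RunInvariant t l S)
    (hl : l.Nodup) {i j x : ℕ} (hi : i < t + 2) (hj : j < t + 2) (hxi : x ∈ S i) (hxj : x ∈ S j) :
    i = j := by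
  by_contra hij
  have h1 := List.nodup_iff_count_le_one.1 hl x
  rw [← Multiset.coe_count, ← hS.entries_eq, entries, Multiset.count_sum'] at h1
  have h2 : ∑ k ∈ {i, j}, Multiset.count x (S k : Multiset ℕ) ≤
      ∑ k ∈ Finset.range (t + 2), Multiset.count x (S k : Multiset ℕ) := by
    apply Finset.sum_le_sum_of_subset
    intro k hk
    simp only [Finset.mem_insert, Finset.mem_singleton] at hk
    rcases hk with rfl | rfl <;> simpa
  rw [Finset.sum_pair hij, Multiset.coe_count, Multiset.coe_count] at h2
  have h3 := List.count_pos_iff.2 hxi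
  have h4 := List.count_pos_iff.2 hxj
  omega

theorem RunInvariant.mem_iff {t : ℕ} {l : List ℕ} {S : StackConfig} (hS : RunInvariant t l S)
    {x : ℕ} : x ∈ l ↔ ∃ j < t + 2, x ∈ S j := by
  rw [← Multiset.mem_coe, ← hS.entries_eq, entries, Multiset.mem_sum]
  simp

theorem RunInvariant.sorted_of_stuck {t n : ℕ} (ht : 1 ≤ t) {l : List ℕ} {S : StackConfig}
    (hS : RunInvariant t l S) (hl : l.Perm (List.range' 1 n)) (hav : ReverseAvoids t l.reverse)
    (hstuck : ∀ k ≤ t, ¬ S.Legal t k) : (S (t + 1)).reverse = List.range' 1 n := by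
  have hnd : l.Nodup := hl.nodup_iff.2 List.nodup_range'
  have hlmem : ∀ x, x ∈ l ↔ 1 ≤ x ∧ x < 1 + n := fun x => by rw [hl.mem_iff, List.mem_range'_1]
  obtain ⟨m, hm⟩ : ∃ m, (S (t + 1)).length = m := ⟨_, rfl⟩
  have hout := hS.output_eq
  rw [hm] at hout
  have houtmem : ∀ x, x ∈ S (t + 1) ↔ 1 ≤ x ∧ x < 1 + m := fun x => by
    rw [hout, List.mem_reverse, List.mem_range'_1]
  rcases lt_trichotomy m n with hmn | hmn | hmn
  rotate_left
  · rw [hout, List.reverse_reverse, hmn]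
  · have h1 := (houtmem (n + 1)).2 (by omega)
    have h2 := (hlmem (n + 1)).1 (hS.mem_iff.2 ⟨t + 1, by omega, h1⟩)
    omega
  exfalso
  have hge : ∀ j ≤ t, ∀ x ∈ S j, m + 1 ≤ x := by
    intro j hj x hx
    by_contra hlt
    have h1 := (hlmem x).1 (hS.mem_iff.2 ⟨j, by omega, hx⟩)
    have := hS.disjoint hnd (by omega) (by omega) hx ((houtmem x).2 (by omega))
    omega
  obtain ⟨j, hj, haj⟩ := hS.mem_iff.1 ((hlmem (m + 1)).2 (by omega))
  have hjt : j ≤ t := by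
    by_contra hjt
    rw [show j = t + 1 by omega] at haj
    have := (houtmem _).1 haj
    omega
  -- As the smallest entry not yet output, `m + 1` could move from the head of any container, into
  -- the next stack or to the output.
  have hnothead : ¬ m + 1 ∈ (S j).head? := by
    intro hh
    apply hstuck j hjt
    refine ⟨m + 1, hh, ?_⟩
    rcases hjt.lt_or_eq with hlt | heq
    · left
      refine ⟨hlt, fun y hy => ?_⟩
      have hy := List.mem_of_mem_head? hy
      have h1 := hge _ (by omega) y hy
      rcases h1.lt_or_eq with h1 | h1
      · exact h1
      · rw [← h1] at hy
        have := hS.disjoint hnd hj (by omega) haj hy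
        omega
    · right
      exact ⟨heq, by rw [hm]⟩
  cases hSj : S j with
  | nil => simp [hSj] at haj
  | cons c v =>
    have hca : c ≠ m + 1 := fun h => hnothead (by simp [hSj, h])
    have hcge := hge j hjt c (by simp [hSj])
    have hav' : m + 1 ∈ v := by
      rw [hSj] at haj
      exact (List.mem_cons.1 haj).resolve_left hca.symm
    -- In a stack, `m + 1` would be at the top because stacks increase; so it lies in the input
    -- behind the head `c`.
    rcases Nat.eq_zero_or_pos j with rfl | hjpos
    -- The entry `c` is blocked by a smaller top of the first stack; that top, being blocked in
    -- turn, forces a still smaller top in the second stack, and so on.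
    · have hchain : ∀ i, 1 ≤ i → i ≤ t → ∃ y ∈ (S i).head?, y < c := by
        intro i hi
        induction i, hi using Nat.le_induction with
        | base =>
          intro _
          by_contra hno
          push Not at hno
          apply hstuck 0 (by omega)
          refine ⟨c, by simp [hSj], Or.inl ⟨by omega, fun y hy => ?_⟩⟩
          refine lt_of_le_of_ne (hno y hy) fun heq => ?_
          subst heq
          have := hS.disjoint hnd (show 0 < t + 2 by omega) (show 0 + 1 < t + 2 by omega)
            (x := c) (by simp [hSj]) (List.mem_of_mem_head? hy)
          omega
        | succ i hi ih =>
          intro hit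
          obtain ⟨x, hx, hxc⟩ := ih (by omega)
          by_contra hno
          push Not at hno
          apply hstuck i (by omega)
          exact ⟨x, hx, Or.inl ⟨by omega, fun y hy => hxc.trans_le (hno y hy)⟩⟩
      choose! b hb hbc using hchain
      obtain ⟨u, hu, hmem⟩ := hS.consumed
      rw [hSj] at hu
      rw [hu] at hav
      have hlt := hav.countP_lt hav' (by omega)
      rw [List.countP_eq_length_filter] at hlt
      have hmemb : ∀ i < t, b (i + 1) ∈ S (i + 1) := fun i hi =>
        List.mem_of_mem_head? (hb (i + 1) (by omega) (by omega))
      have hnodup : ((List.range t).map fun i => b (i + 1)).Nodup := by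
        refine List.Nodup.map_on ?_ List.nodup_range
        intro i hi i' hi' h
        rw [List.mem_range] at hi hi'
        have h2 := hmemb i' hi'
        rw [← h] at h2
        have := hS.disjoint hnd (by omega) (by omega) (hmemb i hi) h2
        omega
      -- The t tops are distinct entries read before `c` with values in [m+1, c), whereas avoidance
      -- allows fewer than t of these.
      have hsub := hnodup.subperm
        (l₂ := u.filter fun x => decide (m + 1 ≤ x ∧ x < c)) (by
          intro x hx
          obtain ⟨i, hi, rfl⟩ := List.mem_map.1 hx
          rw [List.mem_range] at hi
          have h1 := hge (i + 1) (by omega) _ (hmemb i hi)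
          have h2 := hbc (i + 1) (by omega) (by omega)
          simp only [List.mem_filter, decide_eq_true_eq]
          exact ⟨hmem (i + 1) (by omega) _ (hmemb i hi), h1, h2⟩)
      have := hsub.length_le
      simp only [List.length_map, List.length_range] at this
      omega
    · have := hS.stacks_sorted j hjpos hjt
      rw [hSj] at this
      have := List.rel_of_pairwise_cons this hav'
      omega

theorem exists_step {t k : ℕ} {S : StackConfig} (hk : k ≤ t) (h : S.Legal t k) :
    ∃ S', LeftGreedyStep t S S' := by
  classical
  refine ⟨_, Nat.findGreatest (S.Legal t) t, Nat.findGreatest_le t,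
    Nat.findGreatest_spec hk h, fun j hj hjt => Nat.findGreatest_is_greatest hj hjt, rfl⟩

theorem progress_le {t : ℕ} {l : List ℕ} {S : StackConfig} (hS : RunInvariant t l S) :
    progress t S ≤ (t + 1) * l.length := by
  have h := congrArg Multiset.card hS.entries_eq
  rw [entries, Multiset.card_sum] at h
  simp only [Multiset.coe_card] at h
  rw [← h, Finset.mul_sum]
  refine Finset.sum_le_sum fun j hj => ?_
  rw [Finset.mem_range] at hj
  exact Nat.mul_le_mul_right _ (by omega)

theorem sortsList_of_reverseAvoids {t n : ℕ} (ht : 1 ≤ t) {l : List ℕ}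
    (hl : l.Perm (List.range' 1 n)) (hav : ReverseAvoids t l.reverse) : SortsList t l := by
  have hlen : l.length = n := by simpa using hl.length_eq
  -- Induction on the moves still available: each entry makes at most t+1 of them.
  have key : ∀ d, ∀ S, RunInvariant t l S → (t + 1) * l.length - progress t S = d →
      ∃ S', Relation.ReflTransGen (LeftGreedyStep t) S S' ∧
        (S' (t + 1)).reverse = List.range' 1 n := by
    intro d
    induction d with
    | zero =>
      intro S hS hd
      refine ⟨S, .refl, hS.sorted_of_stuck ht hl hav fun k hk hleg => ?_⟩
      obtain ⟨S', h'⟩ := exists_step hk hleg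
      have h1 := progress_step h'
      have h2 := progress_le (hS.step h')
      omega
    | succ d ih =>
      intro S hS hd
      by_cases hex : ∃ k ≤ t, S.Legal t k
      · obtain ⟨k, hk, hleg⟩ := hex
        obtain ⟨S', h'⟩ := exists_step hk hleg
        have h1 := progress_step h'
        obtain ⟨S'', h2, h3⟩ := ih S' (hS.step h') (by omega)
        exact ⟨S'', h2.head h', h3⟩
      · push Not at hex
        exact ⟨S, .refl, hS.sorted_of_stuck ht hl hav hex⟩
  obtain ⟨S, h1, h2⟩ := key _ _ (runInvariant_inputConfig t l) rfl
  exact ⟨S, h1, by rw [h2, hlen]⟩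

/-! ### Codes -/

/-- Raise the entries that are at least `v` by one. -/
def raiseFrom (v x : ℕ) : ℕ := if x < v then x else x + 1

theorem raiseFrom_injective (v : ℕ) : Function.Injective (raiseFrom v) := by
  intro x y h
  unfold raiseFrom at h
  split_ifs at h <;> omega

/-- `raiseFrom v` is strictly increasing, and `ha` says that the threshold moves along with it, so
all the counts are unchanged. -/
theorem Insertable.map_raiseFrom {t a a' v : ℕ} {r : List ℕ} (h : Insertable t a r)
    (ha : ∀ x, a' ≤ raiseFrom v x ↔ a ≤ x) : Insertable t a' (r.map (raiseFrom v)) := by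
  induction r with
  | nil => trivial
  | cons c r ih =>
    refine ⟨fun hc => ?_, ih h.2⟩
    have := h.1 ((ha c).1 hc)
    rw [List.countP_map]
    convert this using 3 with x
    simp only [Function.comp, ha, decide_eq_decide]
    have : raiseFrom v x < raiseFrom v c ↔ x < c := by
      unfold raiseFrom
      split_ifs <;> omega
    rw [this]

theorem ReverseAvoids.map_raiseFrom {t v : ℕ} {r : List ℕ} (h : ReverseAvoids t r) :
    ReverseAvoids t (r.map (raiseFrom v)) := by
  induction r with
  | nil => trivial
  | cons a r ih =>
    refine ⟨h.1.map_raiseFrom fun x => ?_, ih h.2⟩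
    unfold raiseFrom
    split_ifs <;> omega

/-- The reverse of the permutation obtained by appending to that with reverse `r` a new last
entry `v`. -/
def insertLast (v : ℕ) (r : List ℕ) : List ℕ := v :: r.map (raiseFrom v)

theorem insertLast_perm {v n : ℕ} {r : List ℕ} (h : r.Perm (List.range' 1 n)) (h1 : 1 ≤ v)
    (h2 : v ≤ n + 1) : (insertLast v r).Perm (List.range' 1 (n + 1)) := by
  have hnd : r.Nodup := h.nodup_iff.2 List.nodup_range'
  have hmem : ∀ x, x ∈ r ↔ 1 ≤ x ∧ x < 1 + n := fun x => by rw [h.mem_iff, List.mem_range'_1]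
  rw [List.perm_ext_iff_of_nodup _ List.nodup_range']
  · intro a
    simp only [insertLast, List.mem_cons, List.mem_map, List.mem_range'_1, hmem]
    constructor
    · rintro (rfl | ⟨x, hx, rfl⟩)
      · omega
      · unfold raiseFrom
        split_ifs <;> omega
    · intro ha
      rcases lt_trichotomy a v with hav | hav | hav
      · exact Or.inr ⟨a, by omega, by simp [raiseFrom, hav]⟩
      · exact Or.inl hav
      · refine Or.inr ⟨a - 1, by omega, ?_⟩
        unfold raiseFrom
        rw [if_neg] <;> omega
  · refine List.nodup_cons.2 ⟨?_, hnd.map (raiseFrom_injective v)⟩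
    rw [List.mem_map]
    rintro ⟨x, -, hx⟩
    unfold raiseFrom at hx
    split_ifs at hx <;> omega

/-- The reverse of the permutation in which each entry is preceded by the prescribed number of
larger entries (prescribed from right to left). -/
def decode : List ℕ → List ℕ
  | [] => []
  | e :: es => insertLast (es.length + 1 - e) (decode es)

/-- The number of ways to append a last entry to the permutation with code `es`. -/
def label (t : ℕ) : List ℕ → ℕ
  | [] => 1
  | e :: es => e + 1 + min t (label t es - e)

/-- Codes of permutations obtained from the empty one by admissible insertions of last entries. -/
def ValidCode (t : ℕ) : List ℕ → Prop
  | [] => True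
  | e :: es => e < label t es ∧ ValidCode t es

theorem label_le (t : ℕ) {es : List ℕ} (h : ValidCode t es) : label t es ≤ es.length + 1 := by
  induction es with
  | nil => simp [label]
  | cons e es ih =>
    have := ih h.2
    have := h.1
    simp only [label, List.length_cons]
    omega

theorem decode_perm {t : ℕ} {es : List ℕ} (h : ValidCode t es) :
    (decode es).Perm (List.range' 1 es.length) := by
  induction es with
  | nil => simp [decode]
  | cons e es ih =>
    have := label_le t h.2
    have := h.1
    exact insertLast_perm (ih h.2) (by omega) (by omega)

theorem countP_Ico_le {r : List ℕ} (h : r.Nodup) (a v : ℕ) :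
    r.countP (fun b => a ≤ b ∧ b < v) ≤ v - a := by
  rw [List.countP_eq_length_filter]
  refine ((h.filter _).subperm (l₂ := List.range' a (v - a)) fun x hx => ?_).length_le.trans_eq
    List.length_range'
  simp only [List.mem_filter, decide_eq_true_eq] at hx
  rw [List.mem_range'_1]
  omega

/-- The `label t es` largest values are admissible. After appending v, a value a > v was admissible
before as a - 1, which gives e + 1 values. A value a ≤ v must have been admissible before and must
satisfy v - a < t, because at most v - a earlier entries lie in [a, v); this gives min(t, k - e)
values, k being the old label. -/
theorem insertable_decode {t : ℕ} {es : List ℕ} (h : ValidCode t es) :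
    ∀ a, es.length + 2 ≤ a + label t es → Insertable t a (decode es) := by
  induction es with
  | nil => intros; trivial
  | cons e es ih =>
    have h0 := label_le t h.2
    have h1 := h.1
    intro a ha
    simp only [label, List.length_cons] at ha
    obtain ⟨v, hv⟩ : ∃ v, es.length + 1 - e = v := ⟨_, rfl⟩
    have hnd : (decode es).Nodup := (decode_perm h.2).nodup_iff.2 List.nodup_range'
    have hnd' := hnd.map (raiseFrom_injective v)
    simp only [decode, insertLast, hv]
    refine ⟨fun hav => (countP_Ico_le hnd' a v).trans_lt (by omega), ?_⟩
    rcases le_or_gt a v with hav | hav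
    · refine (ih h.2 a (by omega)).map_raiseFrom fun x => ?_
      unfold raiseFrom
      split_ifs <;> omega
    · refine (ih h.2 (a - 1) (by omega)).map_raiseFrom fun x => ?_
      unfold raiseFrom
      split_ifs <;> omega

theorem reverseAvoids_decode {t : ℕ} {es : List ℕ} (h : ValidCode t es) :
    ReverseAvoids t (decode es) := by
  induction es with
  | nil => trivial
  | cons e es ih =>
    have h0 := label_le t h.2
    have h1 := h.1
    refine ⟨(insertable_decode h.2 (es.length + 1 - e) (by omega)).map_raiseFrom fun x => ?_,
      (ih h.2).map_raiseFrom⟩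
    unfold raiseFrom
    split_ifs <;> omega

/-- The last entry determines the code's head: validity keeps the subtraction in `decode` from being
truncated. -/
theorem decode_injOn {t : ℕ} {es fs : List ℕ} (he : ValidCode t es) (hf : ValidCode t fs)
    (hlen : es.length = fs.length) (h : decode es = decode fs) : es = fs := by
  induction es generalizing fs with
  | nil => exact (List.eq_nil_of_length_eq_zero hlen.symm).symm
  | cons e es ih =>
    cases fs with
    | nil => simp at hlen
    | cons f fs =>
      have hlen' : es.length = fs.length := by simpa using hlen
      have h1 := label_le t he.2
      have h2 := he.1
      have h3 := label_le t hf.2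
      have h4 := hf.1
      simp only [decode, insertLast, List.cons.injEq] at h
      obtain ⟨h5, h6⟩ := h
      rw [h5] at h6
      rw [ih he.2 hf.2 hlen' (List.map_injective_iff.2 (raiseFrom_injective _) h6),
        show e = f by omega]

/-- The valid codes of permutations of length `n`. -/
def codes (t : ℕ) : ℕ → Finset (List ℕ)
  | 0 => {[]}
  | n + 1 => (codes t n).biUnion fun es => (Finset.range (label t es)).image (· :: es)

theorem mem_codes {t n : ℕ} {es : List ℕ} (h : es ∈ codes t n) :
    ValidCode t es ∧ es.length = n := by
  induction n generalizing es with
  | zero =>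
    rw [codes, Finset.mem_singleton] at h
    subst h
    exact ⟨trivial, rfl⟩
  | succ n ih =>
    simp only [codes, Finset.mem_biUnion, Finset.mem_image, Finset.mem_range] at h
    obtain ⟨es, hes, e, he, rfl⟩ := h
    exact ⟨⟨he, (ih hes).1⟩, by simp [(ih hes).2]⟩

/-- The number of ways to append `n` further entries to a permutation with label `k`. -/
def extensionCount (t : ℕ) : ℕ → ℕ → ℕ
  | 0, _ => 1
  | n + 1, k => ∑ e ∈ Finset.range k, extensionCount t n (e + 1 + min t (k - e))

theorem sum_codes_succ (t n : ℕ) (f : ℕ → ℕ) :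
    ∑ es ∈ codes t (n + 1), f (label t es) =
      ∑ es ∈ codes t n, ∑ e ∈ Finset.range (label t es), f (e + 1 + min t (label t es - e)) := by
  rw [codes, Finset.sum_biUnion]
  · refine Finset.sum_congr rfl fun es _ => ?_
    rw [Finset.sum_image fun e _ e' _ h => (List.cons.inj h).1]
    rfl
  · intro es _ fs _ hne
    rw [Function.onFun, Finset.disjoint_left]
    simp only [Finset.mem_image, not_exists, not_and]
    rintro x ⟨e, -, rfl⟩ f - h
    exact hne (List.cons.inj h).2.symm

/-- Counting nodes of the generating tree by their ancestors at level n; m = 0 gives the number of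
codes. -/
theorem sum_codes (t m n : ℕ) :
    ∑ es ∈ codes t n, extensionCount t m (label t es) = extensionCount t (m + n) 1 := by
  induction n generalizing m with
  | zero => simp [codes, label]
  | succ n ih =>
    rw [sum_codes_succ, show m + (n + 1) = m + 1 + n by ring, ← ih (m + 1)]
    rfl

theorem card_codes (t n : ℕ) : (codes t n).card = extensionCount t n 1 := by
  have := sum_codes t 0 n
  simpa [extensionCount] using this

theorem extensionCount_le_ncard {t : ℕ} (ht : 1 ≤ t) (n : ℕ) :
    extensionCount t n 1 ≤ (sortableLists t n).ncard := by
  rw [← card_codes, ← Set.ncard_coe_finset]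
  refine Set.ncard_le_ncard_of_injOn (fun es => (decode es).reverse) ?_ ?_
    (finite_sortableLists t n)
  · intro es hes
    obtain ⟨hv, hlen⟩ := mem_codes hes
    have hp := (List.reverse_perm _).trans (decode_perm hv)
    rw [hlen] at hp
    exact ⟨hp, sortsList_of_reverseAvoids ht hp (by
      rw [List.reverse_reverse]; exact reverseAvoids_decode hv)⟩
  · intro es hes fs hfs h
    obtain ⟨hv, hlen⟩ := mem_codes hes
    obtain ⟨hv', hlen'⟩ := mem_codes hfs
    exact decode_injOn hv hv' (hlen.trans hlen'.symm) (List.reverse_injective h)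

/-! ### Growth rate of the number of codes -/

/-- For e < h the minimum in the rule is t; each of the remaining t values of e gives the same label
t + h + 1. -/
theorem extensionCount_succ_add (t n h : ℕ) :
    extensionCount t (n + 1) (t + h) =
      ∑ e ∈ Finset.range h, extensionCount t n (t + e + 1) +
        t * extensionCount t n (t + h + 1) := by
  rw [extensionCount, Nat.add_comm t h, Finset.sum_range_add]
  congr 1
  · refine Finset.sum_congr rfl fun e he => ?_
    rw [Finset.mem_range] at he
    congr 1
    omega
  · rw [Finset.sum_congr rfl (g := fun _ => extensionCount t n (h + t + 1)) fun e he => ?_]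
    · simp
    · rw [Finset.mem_range] at he
      congr 1
      omega

/-- Subtracting the preceding formula for consecutive h removes the sum. -/
theorem extensionCount_recurrence (t n h : ℕ) :
    extensionCount t (n + 1) (t + h + 1) + t * extensionCount t n (t + h + 1) =
      extensionCount t (n + 1) (t + h) + t * extensionCount t n (t + h + 2) +
        extensionCount t n (t + h + 1) := by
  rw [show t + h + 1 = t + (h + 1) by ring, extensionCount_succ_add, extensionCount_succ_add,
    Finset.sum_range_succ]
  simp only [← Nat.add_assoc]
  ring

/-- The largest choice e = k turns the label k + 1 into k + 2. Hence every positive label occurs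
below the root, and bounds for the root carry over to all labels. -/
theorem extensionCount_succ_right_le {t : ℕ} (ht : 1 ≤ t) (n k : ℕ) :
    extensionCount t n (k + 2) ≤ extensionCount t (n + 1) (k + 1) := by
  rw [extensionCount]
  have := Finset.single_le_sum (f := fun e => extensionCount t n (e + 1 + min t (k + 1 - e)))
    (fun _ _ => Nat.zero_le _) (Finset.self_mem_range_succ k)
  refine le_trans (le_of_eq ?_) this
  congr 1
  omega

theorem extensionCount_le {t : ℕ} (ht : 1 ≤ t) (n k : ℕ) :
    extensionCount t n (k + 1) ≤ extensionCount t (n + k) 1 := by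
  induction k generalizing n with
  | zero => rfl
  | succ k ih =>
    refine (extensionCount_succ_right_le ht n k).trans ((ih (n + 1)).trans_eq ?_)
    congr 1
    ring

theorem extensionCount_pos {t : ℕ} (ht : 1 ≤ t) (n k : ℕ) : 0 < extensionCount t n (k + 1) := by
  induction n generalizing k with
  | zero => exact Nat.one_pos
  | succ n ih => exact (ih (k + 1)).trans_le (extensionCount_succ_right_le ht n k)

/-- A linear recurrence of order two whose characteristic polynomial has no real root has no
positive solution. -/
theorem false_of_positive_solution {a b c : ℝ} (ha : 0 < a) (hdisc : b ^ 2 < 4 * a * c)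
    {g : ℕ → ℝ} (hg : ∀ k, 0 < g k) (hrec : ∀ k, a * g (k + 2) = b * g (k + 1) - c * g k) :
    False := by
  obtain ⟨r, hr⟩ : ∃ r : ℕ → ℝ, ∀ k, r k = g (k + 1) / g k := ⟨_, fun _ => rfl⟩
  have hrpos : ∀ k, 0 < r k := fun k => by rw [hr]; exact div_pos (hg _) (hg _)
  have hstep : ∀ k, a * r (k + 1) * r k = b * r k - c := by
    intro k
    have h1 := (hg k).ne'
    have h2 := (hg (k + 1)).ne'
    rw [hr, hr]
    field_simp
    linear_combination hrec k
  obtain ⟨d, hd⟩ : ∃ d, d = c - b ^ 2 / (4 * a) := ⟨_, rfl⟩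
  have hdpos : 0 < d := by
    rw [hd, sub_pos, div_lt_iff₀ (by positivity)]
    linarith
  -- Completing the square: the ratios decrease, with drops bounded below by d / (a r₀), so they
  -- would eventually become negative.
  have hdrop : ∀ k, d ≤ a * (r k - r (k + 1)) * r k := by
    intro k
    have h1 : a * (r k - r (k + 1)) * r k - d = a * (r k - b / (2 * a)) ^ 2 := by
      have h2 : a * (r k - b / (2 * a)) ^ 2 = a * r k ^ 2 - b * r k + b ^ 2 / (4 * a) := by
        field_simp
        ring
      rw [h2, hd]
      linear_combination -hstep k
    have : 0 ≤ a * (r k - b / (2 * a)) ^ 2 := by positivity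
    linarith
  have hanti : ∀ k, r k ≤ r 0 - k * (d / (a * r 0)) ∧ r k ≤ r 0 := by
    intro k
    induction k with
    | zero => simp
    | succ k ih =>
      have h0 := hrpos 0
      have hk := hrpos k
      have h1 : 0 < r k - r (k + 1) := by
        have h2 := hdpos.trans_le (hdrop k)
        exact pos_of_mul_pos_right (pos_of_mul_pos_left h2 hk.le) ha.le
      have h2 : d / (a * r 0) ≤ r k - r (k + 1) := by
        rw [div_le_iff₀ (by positivity)]
        have h3 : a * (r k - r (k + 1)) * r k ≤ a * (r k - r (k + 1)) * r 0 :=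
          mul_le_mul_of_nonneg_left ih.2 (by positivity)
        linarith [hdrop k]
      push_cast
      constructor <;> linarith [ih.1, ih.2]
  obtain ⟨N, hN⟩ := exists_nat_gt (r 0 / (d / (a * r 0)))
  have h0 := hrpos 0
  rw [div_lt_iff₀ (by positivity)] at hN
  linarith [(hanti N).1, hrpos N]

theorem growth_extensionCount {t : ℕ} (ht : 1 ≤ t) {L : ℝ} (hL : 0 < L)
    (h : ∀ n, (extensionCount t n 1 : ℝ) ≤ L ^ n) : (Real.sqrt t + 1) ^ 2 ≤ L := by
  by_contra! hlt
  obtain ⟨s, hs⟩ : ∃ s, s = Real.sqrt t := ⟨_, rfl⟩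
  have hs0 : 0 ≤ s := hs ▸ Real.sqrt_nonneg _
  have hst : s ^ 2 = t := by rw [hs]; exact Real.sq_sqrt (Nat.cast_nonneg _)
  rw [← hs] at hlt
  -- The choice √L < q makes the series converge at x = q⁻², while |q - s| < 1 makes the
  -- discriminant (q² + s² - 1)² - 4q²s² negative.
  have hmax : max (s - 1) (Real.sqrt L) < s + 1 := by
    refine max_lt (by linarith) ?_
    rw [Real.sqrt_lt' (by linarith)]
    exact hlt
  obtain ⟨q, hq1, hq2⟩ := exists_between hmax
  obtain ⟨hq1, hqL⟩ := max_lt_iff.1 hq1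
  have hq0 : 0 < q := (Real.sqrt_nonneg _).trans_lt hqL
  have hLq : L < q ^ 2 := (Real.sqrt_lt' hq0).1 hqL
  obtain ⟨x, hx⟩ : ∃ x, x = (q ^ 2)⁻¹ := ⟨_, rfl⟩
  have hx0 : 0 < x := by rw [hx]; positivity
  have hxq : x * q ^ 2 = 1 := by rw [hx]; exact inv_mul_cancel₀ (by positivity)
  have hLx : L * x < 1 := by nlinarith
  have hsum : ∀ k, Summable fun n => (extensionCount t n (k + 1) : ℝ) * x ^ n := by
    intro k
    refine Summable.of_nonneg_of_le (fun n => by positivity) (fun n => ?_)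
      ((summable_geometric_of_lt_one (by positivity) hLx).mul_left (L ^ k))
    have h1 : (extensionCount t n (k + 1) : ℝ) ≤ L ^ (n + k) :=
      (Nat.cast_le.2 (extensionCount_le ht n k)).trans (h _)
    calc _ ≤ L ^ (n + k) * x ^ n := by gcongr
      _ = _ := by ring
  obtain ⟨G, hG⟩ : ∃ G : ℕ → ℝ, ∀ k, G k = ∑' n, (extensionCount t n (t + k) : ℝ) * x ^ n :=
    ⟨_, fun _ => rfl⟩
  have hsum' : ∀ k, Summable fun n => (extensionCount t n (t + k) : ℝ) * x ^ n := by
    intro k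
    have := hsum (t - 1 + k)
    rwa [show t - 1 + k + 1 = t + k by omega] at this
  have hGpos : ∀ k, 0 < G k := by
    intro k
    rw [hG]
    refine (hsum' k).tsum_pos (fun n => by positivity) 0 ?_
    simp [extensionCount]
  have hGsucc : ∀ k, G k = 1 + x * ∑' n, (extensionCount t (n + 1) (t + k) : ℝ) * x ^ n := by
    intro k
    rw [hG, (hsum' k).tsum_eq_zero_add, ← tsum_mul_left]
    congr 1
    · simp [extensionCount]
    · refine tsum_congr fun n => ?_
      ring
  have hsum1 : ∀ k, Summable fun n => (extensionCount t (n + 1) (t + k) : ℝ) * x ^ n := by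
    intro k
    have := ((summable_nat_add_iff 1).2 (hsum' k)).mul_left x⁻¹
    refine this.congr fun n => ?_
    field_simp
    ring
  -- Multiply the recurrence by xⁿ and sum over n. The constant terms 1 cancel in G (k+1) - G k, so
  -- the result is homogeneous.
  have hrec : ∀ k, (t : ℝ) * G (k + 2) = (q ^ 2 + t - 1) * G (k + 1) - q ^ 2 * G k := by
    intro k
    have h1 : (∑' n, (extensionCount t (n + 1) (t + (k + 1)) : ℝ) * x ^ n) + t * G (k + 1) =
        (∑' n, (extensionCount t (n + 1) (t + k) : ℝ) * x ^ n) + t * G (k + 2) + G (k + 1) := by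
      rw [hG, hG, ← tsum_mul_left, ← tsum_mul_left,
        ← (hsum1 _).tsum_add ((hsum' _).mul_left _), ← (hsum1 _).tsum_add ((hsum' _).mul_left _),
        ← ((hsum1 _).add ((hsum' _).mul_left _)).tsum_add (hsum' _)]
      refine tsum_congr fun n => ?_
      have := congrArg (fun m : ℕ => (m : ℝ)) (extensionCount_recurrence t n k)
      push_cast at this
      simp only [← Nat.add_assoc]
      linear_combination x ^ n * this
    have h2 := hGsucc k
    have h3 := hGsucc (k + 1)
    linear_combination -h1 - q ^ 2 * (h3 - h2) -
      ((∑' n, (extensionCount t (n + 1) (t + (k + 1)) : ℝ) * x ^ n) -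
        ∑' n, (extensionCount t (n + 1) (t + k) : ℝ) * x ^ n) * hxq
  refine false_of_positive_solution (by exact_mod_cast ht) ?_ hGpos hrec
  rw [← hst]
  have h1 : (q - s) ^ 2 < 1 := by
    rw [sq_lt_one_iff_abs_lt_one, abs_lt]
    constructor <;> linarith
  have h2 : 0 ≤ q ^ 2 + s ^ 2 - 1 := by
    have : (1 : ℝ) ≤ s ^ 2 := by rw [hst]; exact_mod_cast ht
    nlinarith
  calc (q ^ 2 + s ^ 2 - 1) ^ 2 < (2 * q * s) ^ 2 := by
        apply pow_lt_pow_left₀ _ h2 two_ne_zero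
        linarith
    _ = _ := by ring

/-! ### Existence of the growth rate -/

/-- Fekete's lemma for supermultiplicative sequences of positive integers. -/
theorem exists_tendsto_rpow_of_supermultiplicative {a : ℕ → ℕ} (hpos : ∀ n, 0 < a n)
    (hmul : ∀ m n, a m * a n ≤ a (m + n)) {C : ℕ} (hC : ∀ n, a n ≤ C ^ n) :
    ∃ L : ℝ, 0 < L ∧ (∀ n, (a n : ℝ) ≤ L ^ n) ∧
      Filter.Tendsto (fun n : ℕ => (a n : ℝ) ^ (1 / (n : ℝ))) Filter.atTop (nhds L) := by
  have hpos' : ∀ n, (0 : ℝ) < a n := fun n => Nat.cast_pos.2 (hpos n)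
  have hsub : Subadditive fun n => -Real.log (a n) := by
    intro m n
    have : Real.log (a m * a n) ≤ Real.log (a (m + n)) :=
      Real.log_le_log (mul_pos (hpos' m) (hpos' n)) (by exact_mod_cast hmul m n)
    rw [Real.log_mul (hpos' m).ne' (hpos' n).ne'] at this
    linarith
  have hC1 : 1 ≤ C := by
    have := (hpos 1).trans_le (hC 1)
    rwa [pow_one] at this
  have hlogC : 0 ≤ Real.log C := Real.log_nonneg (by exact_mod_cast hC1)
  have hbdd : BddBelow (Set.range fun n : ℕ => -Real.log (a n) / n) := by
    refine ⟨-Real.log C, ?_⟩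
    rintro _ ⟨n, rfl⟩
    rcases Nat.eq_zero_or_pos n with rfl | hn
    · simpa using hlogC
    · have hn' : (0 : ℝ) < n := Nat.cast_pos.2 hn
      have : Real.log (a n) ≤ Real.log ((C : ℝ) ^ n) :=
        Real.log_le_log (hpos' n) (by exact_mod_cast hC n)
      rw [Real.log_pow] at this
      simp only
      rw [le_div_iff₀ hn']
      linarith
  refine ⟨Real.exp (-hsub.lim), Real.exp_pos _, fun n => ?_, ?_⟩
  · rcases Nat.eq_zero_or_pos n with rfl | hn
    · simpa using hC 0
    · have hn' : (0 : ℝ) < n := Nat.cast_pos.2 hn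
      -- Fekete's limit is an infimum, so the bound by Lⁿ holds for every n and not only
      -- asymptotically.
      have := hsub.lim_le_div hbdd hn.ne'
      rw [le_div_iff₀ hn'] at this
      rw [← Real.exp_nat_mul, ← Real.log_le_iff_le_exp (hpos' n)]
      linarith
  · have := (Real.continuous_exp.tendsto _).comp (hsub.tendsto_lim hbdd).neg
    refine this.congr fun n => ?_
    rw [Function.comp, Real.rpow_def_of_pos (hpos' n)]
    congr 1
    ring

theorem corollary2 (t : ℕ) (ht : 1 ≤ t) :
    ∃ L : ℝ,
      Filter.Tendsto (fun n : ℕ => ((leftGreedySortableSet t n).ncard : ℝ) ^ (1 / (n : ℝ)))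
        Filter.atTop (nhds L) ∧
      (Real.sqrt t + 1) ^ 2 ≤ L := by
  have hle := extensionCount_le_ncard ht
  obtain ⟨L, hL, hbound, hlim⟩ := exists_tendsto_rpow_of_supermultiplicative
    (a := fun n => (sortableLists t n).ncard)
    (fun n => (extensionCount_pos ht n 0).trans_le (hle n))
    (ncard_mul_le t) (ncard_sortableLists_le t)
  refine ⟨L, ?_, growth_extensionCount ht hL fun n => (Nat.cast_le.2 (hle n)).trans (hbound n)⟩
  simpa only [ncard_sortableLists] using hlim
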